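/- Let $n\ge 0$ and $[n]=\{1,\dots,n\}$. Encode a monotone (north/east) lattice path with $n$ steps by the set of positions of its north steps. For two such paths $U,L\subseteq[n]$ with the same end point and $U$ weakly above $L$, the lattice path matroid $M[U,L]$ is the matroid on $[n]$ whose bases are all lattice paths with this end point lying weakly between $L$ and $U$. Let $\mathcal P_n$ be the set of lattice path matroids on $[n]$, ordered by $M'\le_q M$ if $M'$ is a quotient of $M$, i.e. if there is a matroid $N$ on the disjoint union of $[n]$ and a finite set $T$ with $M=N\setminus T$ and $M'=N/T$. Its bottom and top elements are the uniform matroids $U_{0,n}$ and $U_{n,n}$. Label a cover $M[U',L']\lessdot M[U,L]$ of $\mathcal P_n$ by the pair $(\ell,u)\in[n]\times[n]$ with $L\setminus L'=\{\ell\}$ and $U\setminus U'=\{u\}$, and order $[n]\times[n]$ componentwise. A maximal chain $U_{0,n}=x_0\lessdot x_1\lessdot\dots\lessdot x_n=U_{n,n}$ with labels $(\ell_i,u_i)$ of $x_{i-1}\lessdot x_i$ is called falling if $(\ell_i,u_i)\not<(\ell_{i+1},u_{i+1})$ for all $1\le i<n$. For $\sigma\in S_n$ let $C_\sigma$ be the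 set of falling chains of $\mathcal P_n$ for which there is $\tau\in S_n$ such that $(\ell_i,u_i)=(\sigma(i),\tau(i))$ for all $i$. Let $l$ be the Coxeter length on $S_n$ with respect to the simple transpositions $s_i=(i\;\,i+1)$, and let $\sigma\preceq_L\sigma'$ denote the left Bruhat order: $\sigma'=s_{i_1}\cdots s_{i_k}\sigma$ for some $i_1,\dots,i_k$ with $l(\sigma')=l(\sigma)+k$. **Theorem.** If $\sigma,\sigma'\in S_n$ satisfy $\sigma\preceq_L\sigma'$, then $|C_\sigma|\le|C_{\sigma'}|$. -/

import Mathlib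

/-! ### Lattice paths

A monotone lattice path with `n` steps is encoded by the set `B : Finset (Fin n)` of the positions
of its north steps. Everything is 0-indexed, so `Fin n` plays the role of `[n]`. -/

/-- The height of the lattice path `B` after its first `i` steps. -/
def pathHeight {n : ℕ} (B : Finset (Fin n)) (i : ℕ) : ℕ :=
  (B.filter fun b => b.val < i).card

/-- `B` is a lattice path with the same end point as `L` that stays weakly above `L` and weakly
below `U`. -/
def IsPathBetween {n : ℕ} (L U B : Finset (Fin n)) : Prop :=
  B.card = L.card ∧ ∀ i : ℕ, pathHeight L i ≤ pathHeight B i ∧ pathHeight B i ≤ pathHeight U i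

theorem pathHeight_insert_erase {n : ℕ} (B : Finset (Fin n)) {x y : Fin n} (hx : x ∈ B)
    (hy : y ∉ B) (i : ℕ) :
    pathHeight (insert y (B.erase x)) i + (if x.val < i then 1 else 0)
      = pathHeight B i + (if y.val < i then 1 else 0) := by
  have hB : B = insert x (B.erase x) := (Finset.insert_erase hx).symm
  have hy' : y ∉ B.erase x := fun h => hy (Finset.mem_of_mem_erase h)
  have h1 : ∀ z : Fin n, z ∉ B.erase x →
      pathHeight (insert z (B.erase x)) i
        = pathHeight (B.erase x) i + (if z.val < i then 1 else 0) := by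
    intro z hz
    unfold pathHeight
    rw [Finset.filter_insert]
    split_ifs with h
    · rw [Finset.card_insert_of_notMem (by simp [hz])]
    · simp
  have h2 := h1 y hy'
  have h3 := h1 x (Finset.notMem_erase x B)
  rw [← hB] at h3
  omega

theorem pathHeight_succ {n : ℕ} (B : Finset (Fin n)) (x : Fin n) :
    pathHeight B (x.val + 1) = pathHeight B x.val + (if x ∈ B then 1 else 0) := by
  unfold pathHeight
  split_ifs with h
  · rw [← Finset.card_insert_of_notMem (a := x) (s := B.filter fun b => b.val < x.val) (by simp)]
    congr 1
    ext b
    simp only [Finset.mem_filter, Finset.mem_insert, Nat.lt_succ_iff]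
    constructor
    · rintro ⟨hb, hle⟩
      rcases Nat.lt_or_eq_of_le hle with h' | h'
      · exact Or.inr ⟨hb, h'⟩
      · exact Or.inl (Fin.ext h')
    · rintro (rfl | ⟨hb, hlt⟩)
      · exact ⟨h, le_rfl⟩
      · exact ⟨hb, hlt.le⟩
  · rw [Nat.add_zero]
    congr 1
    ext b
    simp only [Finset.mem_filter, Nat.lt_succ_iff]
    constructor
    · rintro ⟨hb, hle⟩
      refine ⟨hb, lt_of_le_of_ne hle fun h' => h ?_⟩
      rwa [← Fin.ext h']
    · rintro ⟨hb, hlt⟩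
      exact ⟨hb, hlt.le⟩

theorem pathHeight_zero {n : ℕ} (B : Finset (Fin n)) : pathHeight B 0 = 0 := by
  simp [pathHeight]

theorem pathHeight_last {n : ℕ} (B : Finset (Fin n)) : pathHeight B n = B.card := by
  simp [pathHeight]

theorem pathHeight_injective {n : ℕ} {A B : Finset (Fin n)}
    (h : ∀ i, pathHeight A i = pathHeight B i) : A = B := by
  ext x
  have h1 := h (x.val + 1)
  rw [pathHeight_succ, pathHeight_succ, h x.val] at h1
  by_cases ha : x ∈ A <;> by_cases hb : x ∈ B <;> simp_all

/-- The exchange property for the lattice paths in a region. -/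
theorem isPathBetween_exchange {n : ℕ} {L U A B : Finset (Fin n)} (hA : IsPathBetween L U A)
    (hB : IsPathBetween L U B) {x : Fin n} (hxA : x ∈ A) (hxB : x ∉ B) :
    ∃ y, y ∈ B ∧ y ∉ A ∧ IsPathBetween L U (insert y (A.erase x)) := by
  have hcard : ∀ y, y ∉ A → (insert y (A.erase x)).card = L.card := by
    intro y hy
    rw [Finset.card_insert_of_notMem (fun h => hy (Finset.mem_of_mem_erase h)),
      Finset.card_erase_add_one hxA, hA.1]
  have hend : pathHeight A n = pathHeight B n := by
    rw [pathHeight_last, pathHeight_last, hA.1, hB.1]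
  have hstepA := pathHeight_succ A x
  have hstepB := pathHeight_succ B x
  rw [if_pos hxA] at hstepA
  rw [if_neg hxB] at hstepB
  by_cases hd : pathHeight B (x.val + 1) < pathHeight A (x.val + 1)
  · -- go right to the first place where the two heights agree again
    have hex : ∃ m, x.val + 1 ≤ m ∧ pathHeight A m ≤ pathHeight B m := ⟨n, x.isLt, hend.le⟩
    classical
    obtain ⟨hm1, hm2⟩ := Nat.find_spec hex
    have hmin := fun m => Nat.find_min hex (m := m)
    have hmn : Nat.find hex ≤ n := Nat.find_min' hex ⟨x.isLt, hend.le⟩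
    generalize Nat.find hex = m at *
    have hmx : m ≠ x.val + 1 := by rintro rfl; omega
    obtain ⟨k, rfl⟩ : ∃ k, m = k + 1 := ⟨m - 1, by omega⟩
    have hlt : ∀ j, x.val + 1 ≤ j → j ≤ k → pathHeight B j < pathHeight A j := by
      intro j h1 h2
      have := hmin j (by omega)
      by_contra hc
      exact this ⟨h1, by omega⟩
    have hk := hlt k (by omega) le_rfl
    have hkA := pathHeight_succ A (⟨k, by omega⟩ : Fin n)
    have hkB := pathHeight_succ B (⟨k, by omega⟩ : Fin n)
    simp only at hkA hkB
    have hyA : (⟨k, by omega⟩ : Fin n) ∉ A := by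
      intro h
      rw [if_pos h] at hkA
      split_ifs at hkB <;> omega
    have hyB : (⟨k, by omega⟩ : Fin n) ∈ B := by
      by_contra h
      rw [if_neg h] at hkB
      rw [if_neg hyA] at hkA
      omega
    refine ⟨_, hyB, hyA, hcard _ hyA, fun i => ?_⟩
    have e := pathHeight_insert_erase A hxA hyA i
    have hAi := hA.2 i
    have hBi := hB.2 i
    have := hlt i
    simp only at e
    split_ifs at e <;> constructor <;> omega
  · -- go left to the last place where the two heights agree
    have hlt0 : pathHeight A x.val < pathHeight B x.val := by omega
    classical
    have hex : ∃ m, m ≤ x.val ∧ pathHeight B (x.val - m) ≤ pathHeight A (x.val - m) :=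
      ⟨x.val, le_rfl, by rw [Nat.sub_self, pathHeight_zero, pathHeight_zero]⟩
    obtain ⟨hm1, hm2⟩ := Nat.find_spec hex
    have hmin := fun m => Nat.find_min hex (m := m)
    generalize Nat.find hex = m at *
    have hm0 : m ≠ 0 := by
      rintro rfl
      rw [Nat.sub_zero] at hm2
      omega
    obtain ⟨k, hk⟩ : ∃ k, k = x.val - m := ⟨_, rfl⟩
    rw [← hk] at hm2
    have hlt : ∀ j, k < j → j ≤ x.val → pathHeight A j < pathHeight B j := by
      intro j h1 h2
      have h3 := hmin (x.val - j) (by omega)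
      by_contra hc
      refine h3 ⟨by omega, ?_⟩
      rw [show x.val - (x.val - j) = j by omega]
      omega
    have hk1 := hlt (k + 1) (by omega) (by omega)
    have hkn : k < n := by have := x.isLt; omega
    have hkA := pathHeight_succ A (⟨k, hkn⟩ : Fin n)
    have hkB := pathHeight_succ B (⟨k, hkn⟩ : Fin n)
    simp only at hkA hkB
    have hyA : (⟨k, hkn⟩ : Fin n) ∉ A := by
      intro h
      rw [if_pos h] at hkA
      split_ifs at hkB <;> omega
    have hyB : (⟨k, hkn⟩ : Fin n) ∈ B := by
      by_contra h
      rw [if_neg h] at hkB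
      rw [if_neg hyA] at hkA
      omega
    refine ⟨_, hyB, hyA, hcard _ hyA, fun i => ?_⟩
    have e := pathHeight_insert_erase A hxA hyA i
    have hAi := hA.2 i
    have hBi := hB.2 i
    have := hlt i
    simp only at e
    split_ifs at e <;> constructor <;> omega

/-! ### Lattice path matroids -/

/-- A lattice path matroid `M[U, L]` on the ground set `Fin n`, given by its upper path `U` and
its lower path `L`; the two paths have the same end point and `U` stays weakly above `L`. -/
@[ext] structure LPM (n : ℕ) where
  upper : Finset (Fin n)
  lower : Finset (Fin n)
  card_eq : upper.card = lower.card
  noncrossing : ∀ i : ℕ, pathHeight lower i ≤ pathHeight upper i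

namespace LPM

/-- The matroid `M[U, L]`: its bases are the lattice paths between `L` and `U`. -/
def toMatroid {n : ℕ} (P : LPM n) : Matroid (Fin n) :=
  Matroid.ofExistsFiniteIsBase Set.univ
    (fun B => ∃ F : Finset (Fin n), (F : Set (Fin n)) = B ∧ IsPathBetween P.lower P.upper F)
    ⟨_, ⟨P.lower, rfl, rfl, fun i => ⟨le_rfl, P.noncrossing i⟩⟩, Set.toFinite _⟩
    (by
      rintro _ _ ⟨A, rfl, hA⟩ ⟨B, rfl, hB⟩ x ⟨hxA, hxB⟩
      obtain ⟨y, hyB, hyA, h⟩ := isPathBetween_exchange hA hB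
        (Finset.mem_coe.1 hxA) (fun h => hxB (Finset.mem_coe.2 h))
      exact ⟨y, ⟨Finset.mem_coe.2 hyB, fun h => hyA (Finset.mem_coe.1 h)⟩, _, by simp, h⟩)
    (fun _ _ => Set.subset_univ _)

theorem toMatroid_isBase_iff {n : ℕ} (P : LPM n) (F : Finset (Fin n)) :
    P.toMatroid.IsBase (F : Set (Fin n)) ↔ IsPathBetween P.lower P.upper F := by
  constructor
  · rintro ⟨G, hG, h⟩
    rwa [← Finset.coe_injective hG]
  · exact fun h => ⟨F, rfl, h⟩

/-- The two bounding paths are determined by the matroid, so that `LPM n` is in bijection with the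
set of lattice path matroids on `Fin n`. -/
theorem toMatroid_injective {n : ℕ} : Function.Injective (toMatroid (n := n)) := by
  intro P Q h
  have key : ∀ F, IsPathBetween P.lower P.upper F ↔ IsPathBetween Q.lower Q.upper F := by
    intro F
    rw [← toMatroid_isBase_iff, ← toMatroid_isBase_iff, h]
  have hPl := (key P.lower).1 ⟨rfl, fun i => ⟨le_rfl, P.noncrossing i⟩⟩
  have hQl := (key Q.lower).2 ⟨rfl, fun i => ⟨le_rfl, Q.noncrossing i⟩⟩
  have hPu := (key P.upper).1 ⟨P.card_eq, fun i => ⟨P.noncrossing i, le_rfl⟩⟩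
  have hQu := (key Q.upper).2 ⟨Q.card_eq, fun i => ⟨Q.noncrossing i, le_rfl⟩⟩
  refine LPM.ext (pathHeight_injective fun i => le_antisymm (hPu.2 i).2 (hQu.2 i).2)
    (pathHeight_injective fun i => le_antisymm (hQl.2 i).1 (hPl.2 i).1)

end LPM

instance LPM.instFinite (n : ℕ) : Finite (LPM n) :=
  Finite.of_injective (fun P : LPM n => (P.upper, P.lower)) fun P Q h => by
    simp only [Prod.mk.injEq] at h
    exact LPM.ext h.1 h.2

/-! ### The quotient order -/

/-- `M'` is a quotient of `M` if there are a matroid `N`, on the ground set of `M` enlarged by a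
finite set `T` of new elements, such that `M = N ＼ T` and `M' = N ／ T`. The old elements are
embedded by `Sum.inl`, and `T` is the range of `Sum.inr`. -/
def Matroid.IsQuotientOf {α : Type*} (M' M : Matroid α) : Prop :=
  ∃ (k : ℕ) (N : Matroid (α ⊕ Fin k)),
    N.delete (Set.range Sum.inr) = M.mapEmbedding Function.Embedding.inl ∧
    N.contract (Set.range Sum.inr) = M'.mapEmbedding Function.Embedding.inl

/-- The order on lattice path matroids: `P ≤ Q` if `P` is a matroid quotient of `Q`. -/
instance LPM.instLE (n : ℕ) : LE (LPM n) :=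
  ⟨fun P Q => P.toMatroid.IsQuotientOf Q.toMatroid⟩

/-- The strict order. Covers `P ⋖ Q` are taken with respect to it. -/
instance LPM.instLT (n : ℕ) : LT (LPM n) := ⟨fun P Q => P ≤ Q ∧ P ≠ Q⟩

/-- The uniform matroid `U_{0,n}`, the bottom element. -/
def LPM.bottom (n : ℕ) : LPM n := ⟨∅, ∅, rfl, fun _ => le_rfl⟩

/-- The uniform matroid `U_{n,n}`, the top element. -/
def LPM.top (n : ℕ) : LPM n := ⟨Finset.univ, Finset.univ, rfl, fun _ => le_rfl⟩

/-! ### Maximal chains, the good pair labelling and falling chains -/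

/-- `x 0 ⋖ x 1 ⋖ ⋯ ⋖ x n` is a maximal chain from `U_{0,n}` to `U_{n,n}`. -/
def IsMaximalLPMChain {n : ℕ} (x : Fin (n + 1) → LPM n) : Prop :=
  x 0 = LPM.bottom n ∧ x (Fin.last n) = LPM.top n ∧ ∀ i : Fin n, x i.castSucc ⋖ x i.succ

/-- The pair `(ℓ, u)` is the label of the cover `P ⋖ Q`: the lower path of `P` arises from that of
`Q` by removing `ℓ`, and the upper path by removing `u`. Labels are compared in the product order
on `Fin n × Fin n`. -/
def HasGoodPairLabel {n : ℕ} (P Q : LPM n) (a : Fin n × Fin n) : Prop :=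
  a.1 ∉ P.lower ∧ Q.lower = insert a.1 P.lower ∧ a.2 ∉ P.upper ∧ Q.upper = insert a.2 P.upper

/-- The chain `x` is the maximal chain `C_(σ,τ)`, that is, its sequence of labels is
`((σ 1, τ 1), …, (σ n, τ n))`, read from bottom to top. -/
def IsChainOfPair {n : ℕ} (x : Fin (n + 1) → LPM n) (σ τ : Equiv.Perm (Fin n)) : Prop :=
  IsMaximalLPMChain x ∧ ∀ i : Fin n, HasGoodPairLabel (x i.castSucc) (x i.succ) (σ i, τ i)

/-- A maximal chain is falling if no label is strictly smaller than the next one. -/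
def IsFallingChain {n : ℕ} (x : Fin (n + 1) → LPM n) : Prop :=
  IsMaximalLPMChain x ∧ ∃ m : Fin n → Fin n × Fin n,
    (∀ i : Fin n, HasGoodPairLabel (x i.castSucc) (x i.succ) (m i)) ∧
    ∀ i j : Fin n, i.val + 1 = j.val → ¬ m i < m j

/-- `C_σ`: the falling chains of the form `C_(σ,τ)` for some permutation `τ`. -/
def fallingChains {n : ℕ} (σ : Equiv.Perm (Fin n)) : Set (Fin (n + 1) → LPM n) :=
  {x | IsFallingChain x ∧ ∃ τ : Equiv.Perm (Fin n), IsChainOfPair x σ τ}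

/-! ### Left (weak) Bruhat order -/

/-- The simple transpositions `s_i = (i, i + 1)`. -/
def IsSimpleTransposition {n : ℕ} (s : Equiv.Perm (Fin n)) : Prop :=
  ∃ i j : Fin n, i.val + 1 = j.val ∧ s = Equiv.swap i j

/-- The Coxeter length: the least length of a word in the simple transpositions with product `w`.
(Such words exist for every `w`.) -/
noncomputable def permLength {n : ℕ} (w : Equiv.Perm (Fin n)) : ℕ :=
  sInf {k | ∃ l : List (Equiv.Perm (Fin n)),
    (∀ s ∈ l, IsSimpleTransposition s) ∧ l.prod = w ∧ l.length = k}

/-- `u ⪯_L w`: there are simple transpositions with `w = s_{i_1} ⋯ s_{i_k} u` and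
`ℓ(w) = ℓ(u) + k`. -/
def LeftBruhatLE {n : ℕ} (u w : Equiv.Perm (Fin n)) : Prop :=
  ∃ l : List (Equiv.Perm (Fin n)), (∀ s ∈ l, IsSimpleTransposition s) ∧
    w = l.prod * u ∧ permLength w = permLength u + l.length

/-! The injection keeps `τ` and replaces `σ` by `σ'`. For a permutation `w` and a position `t`, let
`a_w(t)` and `b_w(t)` count the positions before, respectively after, `t` that carry a smaller
value, so that `w t = a_w(t) + b_w(t)`. The pair `(σ, τ)` labels a maximal chain exactly when
`a_σ(t) ≤ a_τ(t)` and `b_τ(t) ≤ b_σ(t)` for all `t`. Going up in the left order enlarges the set of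
inversions, recorded by positions (`LeftBruhatLE.inversions_subset`); this lowers every `a_σ(t)`,
raises every `b_σ(t)` and creates no new ascent of `σ`. Hence both the chain condition and the
falling condition survive (`IsGoodPermPair.of_inversions_subset`,
`IsChainOfPair.isFallingChain_iff`).

The matroid content is the numerical test for a cover, `HasGoodPairLabel.covBy_iff`. Necessity: in a
quotient, every base of the larger matroid contains a base of the smaller one, and every base of the
smaller extends to a base of the larger; an extremal path violates one of these if the inequalities
fail. Sufficiency: the inequalities give mixed exchange properties, from which a one-element
extension is built. -/

/-! ### Inversions of permutations -/

/-- The inversions of `w`, as pairs of positions. -/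
def inversions {n : ℕ} (w : Equiv.Perm (Fin n)) : Finset (Fin n × Fin n) :=
  Finset.univ.filter fun p => p.1 < p.2 ∧ w p.2 < w p.1

theorem mem_inversions {n : ℕ} {w : Equiv.Perm (Fin n)} {p : Fin n × Fin n} :
    p ∈ inversions w ↔ p.1 < p.2 ∧ w p.2 < w p.1 := by
  simp [inversions]

/-- No value lies strictly between `i` and `j`, so exchanging them changes the relative order of no
other pair of positions. -/
theorem inversions_swap_mul {n : ℕ} (w : Equiv.Perm (Fin n)) {i j : Fin n}
    (hij : i.val + 1 = j.val) (h : w⁻¹ i < w⁻¹ j) :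
    inversions (Equiv.swap i j * w) = insert (w⁻¹ i, w⁻¹ j) (inversions w) := by
  ext ⟨a, b⟩
  simp only [mem_inversions, Finset.mem_insert, Prod.mk.injEq, Equiv.Perm.eq_inv_iff_eq,
    Equiv.Perm.coe_mul, Function.comp_apply, Equiv.swap_apply_def]
  have key : ∀ c d : Fin n, w c = i → w d = j → c < d := by
    rintro c d rfl rfl
    simpa using h
  have hne : a < b → (w a).val ≠ (w b).val := fun hab e =>
    hab.ne (w.injective (Fin.ext e))
  have k1 := key a b
  have k2 := key b a
  simp only [Fin.ext_iff, Fin.lt_def] at *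
  split_ifs <;> grind

theorem notMem_inversions_of_lt {n : ℕ} (w : Equiv.Perm (Fin n)) {i j : Fin n}
    (hij : i.val + 1 = j.val) : (w⁻¹ i, w⁻¹ j) ∉ inversions w := by
  rw [mem_inversions]
  rintro ⟨-, h⟩
  have h' : j < i := by simpa using h
  omega

theorem card_inversions_swap_mul_of_lt {n : ℕ} (w : Equiv.Perm (Fin n)) {i j : Fin n}
    (hij : i.val + 1 = j.val) (h : w⁻¹ i < w⁻¹ j) :
    (inversions (Equiv.swap i j * w)).card = (inversions w).card + 1 := by
  rw [inversions_swap_mul w hij h, Finset.card_insert_of_notMem (notMem_inversions_of_lt w hij)]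

theorem card_inversions_swap_mul_of_gt {n : ℕ} (w : Equiv.Perm (Fin n)) {i j : Fin n}
    (hij : i.val + 1 = j.val) (h : w⁻¹ j < w⁻¹ i) :
    (inversions (Equiv.swap i j * w)).card + 1 = (inversions w).card := by
  have := card_inversions_swap_mul_of_lt (Equiv.swap i j * w) hij (by simpa using h)
  rw [← mul_assoc, Equiv.swap_mul_self, one_mul] at this
  exact this.symm

theorem card_inversions_simple_mul_le {n : ℕ} {s : Equiv.Perm (Fin n)}
    (hs : IsSimpleTransposition s) (w : Equiv.Perm (Fin n)) :
    (inversions (s * w)).card ≤ (inversions w).card + 1 := by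
  obtain ⟨i, j, hij, rfl⟩ := hs
  rcases lt_trichotomy (w⁻¹ i) (w⁻¹ j) with h | h | h
  · exact (card_inversions_swap_mul_of_lt w hij h).le
  · have := w⁻¹.injective h
    omega
  · have := card_inversions_swap_mul_of_gt w hij h
    omega

theorem inversions_subset_simple_mul {n : ℕ} {s : Equiv.Perm (Fin n)}
    (hs : IsSimpleTransposition s) {w : Equiv.Perm (Fin n)}
    (h : (inversions w).card < (inversions (s * w)).card) :
    inversions w ⊆ inversions (s * w) := by
  obtain ⟨i, j, hij, rfl⟩ := hs
  rcases lt_trichotomy (w⁻¹ i) (w⁻¹ j) with h' | h' | h'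
  · rw [inversions_swap_mul w hij h']
    exact Finset.subset_insert _ _
  · have := w⁻¹.injective h'
    omega
  · have := card_inversions_swap_mul_of_gt w hij h'
    omega

theorem card_inversions_prod_mul_le {n : ℕ} (w : Equiv.Perm (Fin n))
    (l : List (Equiv.Perm (Fin n))) (hl : ∀ s ∈ l, IsSimpleTransposition s) :
    (inversions (l.prod * w)).card ≤ (inversions w).card + l.length := by
  induction l with
  | nil => simp
  | cons s l ih =>
    have h1 := ih fun t ht => hl t (List.mem_cons_of_mem _ ht)
    have h2 := card_inversions_simple_mul_le (hl s List.mem_cons_self) (l.prod * w)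
    rw [List.prod_cons, mul_assoc, List.length_cons]
    omega

/-- Each factor adds at most one inversion, so equality forces every factor to add one, and a factor
that does so loses none. -/
theorem inversions_subset_prod_mul {n : ℕ} (w : Equiv.Perm (Fin n))
    (l : List (Equiv.Perm (Fin n))) (hl : ∀ s ∈ l, IsSimpleTransposition s)
    (h : (inversions (l.prod * w)).card = (inversions w).card + l.length) :
    inversions w ⊆ inversions (l.prod * w) := by
  induction l with
  | nil => simp
  | cons s l ih =>
    have hl' := fun t ht => hl t (List.mem_cons_of_mem s ht)
    have h1 := card_inversions_prod_mul_le w l hl'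
    have h2 := card_inversions_simple_mul_le (hl s List.mem_cons_self) (l.prod * w)
    rw [List.prod_cons, mul_assoc] at *
    rw [List.length_cons] at h
    exact (ih hl' (by omega)).trans
      (inversions_subset_simple_mul (hl s List.mem_cons_self) (by omega))

/-! ### Coxeter length as the number of inversions -/

theorem inversions_one {n : ℕ} : inversions (1 : Equiv.Perm (Fin n)) = ∅ := by
  ext p
  simp only [mem_inversions, Equiv.Perm.coe_one, id_eq, Finset.notMem_empty, iff_false]
  exact fun h => lt_asymm h.1 h.2

theorem eq_one_of_forall_adjacent_lt {n : ℕ} {w : Equiv.Perm (Fin n)}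
    (h : ∀ i j : Fin n, i.val + 1 = j.val → w i < w j) : w = 1 := by
  cases n with
  | zero => exact Subsingleton.elim _ _
  | succ n =>
    have hm : StrictMono w := Fin.strictMono_iff_lt_succ.2 fun i => h _ _ (by simp)
    have := Subsingleton.elim
      (hm.orderIsoOfSurjective w w.surjective) (OrderIso.refl (Fin (n + 1)))
    ext x
    exact congrArg (fun e : Fin (n + 1) ≃o Fin (n + 1) => (e x).val) this

/-- Sorting by adjacent values: unless `w = 1`, some `i + 1` occurs before `i`, and swapping these
two values removes one inversion. -/
theorem exists_word_of_card_inversions {n : ℕ} (k : ℕ) (w : Equiv.Perm (Fin n))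
    (hk : (inversions w).card = k) :
    ∃ l : List (Equiv.Perm (Fin n)),
      (∀ s ∈ l, IsSimpleTransposition s) ∧ l.prod = w ∧ l.length = k := by
  induction k generalizing w with
  | zero =>
    refine ⟨[], by simp, ?_, rfl⟩
    rw [List.prod_nil]
    refine (eq_one_of_forall_adjacent_lt fun i j hij => ?_).symm
    by_contra hc
    have hne : w i ≠ w j := fun e => by have := w.injective e; omega
    have : (i, j) ∈ inversions w :=
      mem_inversions.2 ⟨by simp only [Fin.lt_def]; omega, lt_of_le_of_ne (not_lt.1 hc) hne.symm⟩
    rw [Finset.card_eq_zero.1 hk] at this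
    simp at this
  | succ k ih =>
    obtain ⟨i, j, hij, h⟩ : ∃ i j : Fin n, i.val + 1 = j.val ∧ ¬ w⁻¹ i < w⁻¹ j := by
      by_contra! hc
      have hw := inv_eq_one.1 (eq_one_of_forall_adjacent_lt hc)
      rw [hw, inversions_one] at hk
      simp at hk
    have hlt : w⁻¹ j < w⁻¹ i := lt_of_le_of_ne (not_lt.1 h) fun e => by
      have := w⁻¹.injective e
      omega
    have hc := card_inversions_swap_mul_of_gt w hij hlt
    obtain ⟨l, hl, hp, hlen⟩ := ih (Equiv.swap i j * w) (by omega)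
    refine ⟨Equiv.swap i j :: l, ?_, ?_, by simp [hlen]⟩
    · intro s hs
      rcases List.mem_cons.1 hs with rfl | hs
      · exact ⟨i, j, hij, rfl⟩
      · exact hl s hs
    · rw [List.prod_cons, hp, ← mul_assoc, Equiv.swap_mul_self, one_mul]

theorem permLength_eq_card_inversions {n : ℕ} (w : Equiv.Perm (Fin n)) :
    permLength w = (inversions w).card := by
  have hw := exists_word_of_card_inversions _ w rfl
  refine le_antisymm (Nat.sInf_le hw) (le_csInf ⟨_, hw⟩ ?_)
  rintro k ⟨l, hl, rfl, rfl⟩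
  simpa [inversions_one] using card_inversions_prod_mul_le 1 l hl

theorem LeftBruhatLE.inversions_subset {n : ℕ} {u w : Equiv.Perm (Fin n)}
    (h : LeftBruhatLE u w) : inversions u ⊆ inversions w := by
  obtain ⟨l, hl, rfl, hlen⟩ := h
  rw [permLength_eq_card_inversions, permLength_eq_card_inversions] at hlen
  exact inversions_subset_prod_mul u l hl hlen

/-! ### Quotients and bases -/

/-- A base of `N ＼ T` together with `T` spans `N`, so it spans `N ／ T`. -/
theorem Matroid.IsQuotientOf.exists_isBase_subset {α : Type*} {M' M : Matroid α}
    (h : M'.IsQuotientOf M) {B : Set α} (hB : M.IsBase B) : ∃ B' ⊆ B, M'.IsBase B' := by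
  obtain ⟨k, N, hd, hc⟩ := h
  have h1 : (M.mapEmbedding Function.Embedding.inl).IsBase
      (Sum.inl '' B : Set (α ⊕ Fin k)) := hB.mapEmbedding _
  rw [← hd, Matroid.delete_isBase_iff] at h1
  have h2 : (N.contract (Set.range Sum.inr)).Spanning (Sum.inl '' B : Set (α ⊕ Fin k)) := by
    rw [Matroid.contract_spanning_iff']
    refine ⟨?_, ?_⟩
    · rw [Matroid.spanning_iff_ground_subset_closure
        (Set.union_subset h1.indep.subset_ground Set.inter_subset_right), ← Matroid.closure_union_closure_left_eq,
        h1.closure_eq_closure, Matroid.closure_union_closure_left_eq]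
      refine subset_trans ?_ (N.subset_closure _)
      intro x hx
      by_cases hx' : x ∈ Set.range Sum.inr
      · exact Or.inr ⟨hx', hx⟩
      · exact Or.inl ⟨hx, hx'⟩
    · rw [Set.disjoint_left]
      rintro _ ⟨x, _, rfl⟩ ⟨y, hy⟩
      simp at hy
  obtain ⟨B', hB', hsub⟩ := h2.exists_isBase_subset
  rw [hc, Matroid.mapEmbedding_isBase_iff] at hB'
  refine ⟨_, fun x hx => ?_, hB'.1⟩
  obtain ⟨y, hy, e⟩ := hsub hx
  exact Sum.inl_injective e ▸ hy

/-- Independence in `N ／ T` passes to `N`, hence to `N ＼ T`. -/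
theorem Matroid.IsQuotientOf.exists_isBase_superset {α : Type*} {M' M : Matroid α}
    (h : M'.IsQuotientOf M) {B' : Set α} (hB' : M'.IsBase B') : ∃ B, B' ⊆ B ∧ M.IsBase B := by
  obtain ⟨k, N, hd, hc⟩ := h
  have h1 : (M'.mapEmbedding Function.Embedding.inl).IsBase
      (Sum.inl '' B' : Set (α ⊕ Fin k)) := hB'.mapEmbedding _
  rw [← hc] at h1
  have h2 : (N.delete (Set.range Sum.inr)).Indep (Sum.inl '' B' : Set (α ⊕ Fin k)) := by
    rw [Matroid.delete_indep_iff]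
    refine ⟨h1.indep.of_contract, ?_⟩
    rw [Set.disjoint_left]
    rintro _ ⟨x, _, rfl⟩ ⟨y, hy⟩
    simp at hy
  obtain ⟨B, hB, hsub⟩ := h2.exists_isBase_superset
  rw [hd, Matroid.mapEmbedding_isBase_iff] at hB
  exact ⟨_, fun x hx => hsub (Set.mem_image_of_mem _ hx), hB.1⟩

theorem LPM.exists_path_subset_of_le {n : ℕ} {P Q : LPM n} (h : P ≤ Q) {B : Finset (Fin n)}
    (hB : IsPathBetween Q.lower Q.upper B) : ∃ B' ⊆ B, IsPathBetween P.lower P.upper B' := by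
  obtain ⟨B', hsub, hB'⟩ :=
    Matroid.IsQuotientOf.exists_isBase_subset h ((Q.toMatroid_isBase_iff B).2 hB)
  obtain ⟨F, rfl⟩ := (Set.toFinite B').exists_finset_coe
  exact ⟨F, Finset.coe_subset.1 hsub, (P.toMatroid_isBase_iff F).1 hB'⟩

theorem LPM.exists_path_superset_of_le {n : ℕ} {P Q : LPM n} (h : P ≤ Q) {B' : Finset (Fin n)}
    (hB' : IsPathBetween P.lower P.upper B') : ∃ B, B' ⊆ B ∧ IsPathBetween Q.lower Q.upper B := by
  obtain ⟨B, hsub, hB⟩ :=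
    Matroid.IsQuotientOf.exists_isBase_superset h ((P.toMatroid_isBase_iff B').2 hB')
  obtain ⟨F, rfl⟩ := (Set.toFinite B).exists_finset_coe
  exact ⟨F, Finset.coe_subset.1 hsub, (Q.toMatroid_isBase_iff F).1 hB⟩

theorem LPM.isPathBetween_lower {n : ℕ} (P : LPM n) :
    IsPathBetween P.lower P.upper P.lower :=
  ⟨rfl, fun i => ⟨le_rfl, P.noncrossing i⟩⟩

theorem LPM.card_lower_le_of_le {n : ℕ} {P Q : LPM n} (h : P ≤ Q) :
    P.lower.card ≤ Q.lower.card := by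
  obtain ⟨B, hsub, hB⟩ := LPM.exists_path_superset_of_le h P.isPathBetween_lower
  exact (Finset.card_le_card hsub).trans hB.1.le

theorem LPM.eq_of_le_of_card_eq {n : ℕ} {P Q : LPM n} (h : P ≤ Q)
    (hc : P.lower.card = Q.lower.card) : P = Q := by
  have key : ∀ F, IsPathBetween P.lower P.upper F ↔ IsPathBetween Q.lower Q.upper F := by
    intro F
    constructor <;> intro hF
    · obtain ⟨B, hsub, hB⟩ := LPM.exists_path_superset_of_le h hF
      rwa [Finset.eq_of_subset_of_card_le hsub (by rw [hB.1, hF.1, hc])]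
    · obtain ⟨B, hsub, hB⟩ := LPM.exists_path_subset_of_le h hF
      rwa [← Finset.eq_of_subset_of_card_le hsub (by rw [hB.1, hF.1, hc])]
  refine LPM.toMatroid_injective (Matroid.ext_isBase rfl fun B _ => ?_)
  obtain ⟨F, rfl⟩ := (Set.toFinite B).exists_finset_coe
  rw [LPM.toMatroid_isBase_iff, LPM.toMatroid_isBase_iff, key]

/-- An intermediate element would share its rank with one end, and comparable elements of equal rank
coincide. Transitivity of the order is not needed. -/
theorem LPM.covBy_of_le_of_card_eq {n : ℕ} {P Q : LPM n} (h : P ≤ Q)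
    (hc : Q.lower.card = P.lower.card + 1) : P ⋖ Q := by
  refine ⟨⟨h, fun e => ?_⟩, fun R hPR hRQ => ?_⟩
  · rw [e] at hc
    omega
  · have h1 := LPM.card_lower_le_of_le hPR.1
    have h2 := LPM.card_lower_le_of_le hRQ.1
    rcases Nat.lt_or_ge P.lower.card R.lower.card with h3 | h3
    · exact hRQ.2 (LPM.eq_of_le_of_card_eq hRQ.1 (by omega))
    · exact hPR.2 (LPM.eq_of_le_of_card_eq hPR.1 (by omega))

/-! ### Heights of lattice paths -/

theorem pathHeight_of_le {n : ℕ} (B : Finset (Fin n)) {i : ℕ} (hi : n ≤ i) :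
    pathHeight B i = B.card := by
  unfold pathHeight
  rw [Finset.filter_true_of_mem fun b _ => b.isLt.trans_le hi]

theorem pathHeight_mono {n : ℕ} (B : Finset (Fin n)) : Monotone (pathHeight B) :=
  fun _ _ hij => Finset.card_le_card (Finset.monotone_filter_right _ fun _ _ h => h.trans_le hij)

theorem pathHeight_succ_le {n : ℕ} (B : Finset (Fin n)) (i : ℕ) :
    pathHeight B (i + 1) ≤ pathHeight B i + 1 := by
  rcases Nat.lt_or_ge i n with h | h
  · have := pathHeight_succ B ⟨i, h⟩
    simp only at this
    split_ifs at this <;> omega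
  · rw [pathHeight_of_le B h, pathHeight_of_le B (by omega)]
    omega

theorem pathHeight_add_le {n : ℕ} (B : Finset (Fin n)) (i k : ℕ) :
    pathHeight B (i + k) ≤ pathHeight B i + k := by
  induction k with
  | zero => simp
  | succ k ih =>
    have := pathHeight_succ_le B (i + k)
    rw [← add_assoc]
    omega

/-- Monotonicity of the number of east steps, `i - pathHeight B i`, written without subtraction. -/
theorem pathHeight_le_add_of_le {n : ℕ} (B : Finset (Fin n)) {i j : ℕ} (h : i ≤ j) :
    pathHeight B j + i ≤ pathHeight B i + j := by
  obtain ⟨k, rfl⟩ := Nat.exists_eq_add_of_le h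
  have := pathHeight_add_le B i k
  omega

theorem pathHeight_insert {n : ℕ} {B : Finset (Fin n)} {x : Fin n} (hx : x ∉ B) (i : ℕ) :
    pathHeight (insert x B) i = pathHeight B i + if x.val < i then 1 else 0 := by
  unfold pathHeight
  rw [Finset.filter_insert]
  split_ifs
  · rw [Finset.card_insert_of_notMem (by simp [hx])]
  · rfl

theorem pathHeight_erase {n : ℕ} {B : Finset (Fin n)} {x : Fin n} (hx : x ∈ B) (i : ℕ) :
    pathHeight (B.erase x) i + (if x.val < i then 1 else 0) = pathHeight B i := by
  rw [← pathHeight_insert (Finset.notMem_erase x B), Finset.insert_erase hx]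

/-- Compares the numbers of north steps in the window from `i` to `j`. -/
theorem pathHeight_add_le_of_subset {n : ℕ} {A B : Finset (Fin n)} (h : A ⊆ B) {i j : ℕ}
    (hij : i ≤ j) : pathHeight A j + pathHeight B i ≤ pathHeight A i + pathHeight B j := by
  induction j, hij using Nat.le_induction with
  | base => omega
  | succ j _ ih =>
    rcases Nat.lt_or_ge j n with hj | hj
    · have h1 := pathHeight_succ A ⟨j, hj⟩
      have h2 := pathHeight_succ B ⟨j, hj⟩
      have h3 : (⟨j, hj⟩ : Fin n) ∈ A → (⟨j, hj⟩ : Fin n) ∈ B := fun hh => h hh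
      simp only at h1 h2
      split_ifs at h1 h2 <;> first | omega | tauto
    · rw [pathHeight_of_le A hj, pathHeight_of_le B hj] at ih
      rw [pathHeight_of_le A (by omega : n ≤ j + 1), pathHeight_of_le B (by omega : n ≤ j + 1)]
      exact ih

theorem exists_pathHeight_eq {n : ℕ} (h : ℕ → ℕ) (h0 : h 0 = 0)
    (hs : ∀ i, h i ≤ h (i + 1) ∧ h (i + 1) ≤ h i + 1) :
    ∃ B : Finset (Fin n), ∀ i ≤ n, pathHeight B i = h i := by
  refine ⟨Finset.univ.filter fun b => h (b.val + 1) = h b.val + 1, fun i => ?_⟩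
  induction i with
  | zero => simp [pathHeight_zero, h0]
  | succ i ih =>
    intro hi
    have h1 := pathHeight_succ (Finset.univ.filter fun b : Fin n => h (b.val + 1) = h b.val + 1)
      ⟨i, hi⟩
    have h2 := ih (by omega)
    have h3 := hs i
    simp only [Finset.mem_filter, Finset.mem_univ, true_and] at h1
    split_ifs at h1 <;> omega

theorem isPathBetween_of_forall_le {n : ℕ} {L U B : Finset (Fin n)} (hc : U.card = L.card)
    (h : ∀ i ≤ n, pathHeight L i ≤ pathHeight B i ∧ pathHeight B i ≤ pathHeight U i) :
    IsPathBetween L U B := by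
  have hn := h n le_rfl
  simp only [pathHeight_last] at hn
  refine ⟨by omega, fun i => ?_⟩
  rcases Nat.lt_or_ge n i with hi | hi
  · simp only [pathHeight_of_le _ hi.le]
    exact hn
  · exact h i hi

/-- The path that follows the profile `g` as closely as the two bounding paths allow. -/
theorem LPM.exists_path_clamp {n : ℕ} (P : LPM n) (g : ℕ → ℕ)
    (hg : ∀ i, g i ≤ g (i + 1) ∧ g (i + 1) ≤ g i + 1) :
    ∃ B, IsPathBetween P.lower P.upper B ∧ ∀ i ≤ n,
      pathHeight B i = max (pathHeight P.lower i) (min (pathHeight P.upper i) (g i)) := by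
  obtain ⟨B, hB⟩ := exists_pathHeight_eq (n := n)
    (fun i => max (pathHeight P.lower i) (min (pathHeight P.upper i) (g i)))
    (by simp [pathHeight_zero]) (fun i => by
      have h1 := pathHeight_succ_le P.lower i
      have h2 := pathHeight_succ_le P.upper i
      have h3 := pathHeight_mono P.lower (Nat.le_succ i)
      have h4 := pathHeight_mono P.upper (Nat.le_succ i)
      have h5 := hg i
      simp only [Nat.succ_eq_add_one] at *
      omega)
  refine ⟨B, isPathBetween_of_forall_le P.card_eq fun i hi => ?_, hB⟩
  have := P.noncrossing i
  rw [hB i hi]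
  omega

/-! ### Labels of quotients -/

/-- The numerical condition on the label `(ℓ, u)` for a cover above `P`: the lower path has at
`ℓ` no more north steps behind it than the upper path at `u`, and no fewer east steps. -/
def LPM.IsGoodPair {n : ℕ} (P : LPM n) (a : Fin n × Fin n) : Prop :=
  pathHeight P.lower a.1 ≤ pathHeight P.upper a.2 ∧
    a.2.val + pathHeight P.lower a.1 ≤ a.1.val + pathHeight P.upper a.2

theorem HasGoodPairLabel.pathHeight_lower {n : ℕ} {P Q : LPM n} {a : Fin n × Fin n}
    (h : HasGoodPairLabel P Q a) (i : ℕ) :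
    pathHeight Q.lower i = pathHeight P.lower i + if a.1.val < i then 1 else 0 := by
  rw [h.2.1, pathHeight_insert h.1]

theorem HasGoodPairLabel.pathHeight_upper {n : ℕ} {P Q : LPM n} {a : Fin n × Fin n}
    (h : HasGoodPairLabel P Q a) (i : ℕ) :
    pathHeight Q.upper i = pathHeight P.upper i + if a.2.val < i then 1 else 0 := by
  rw [h.2.2.2, pathHeight_insert h.2.2.1]

theorem HasGoodPairLabel.pathHeight_lower_succ {n : ℕ} {P Q : LPM n} {a : Fin n × Fin n}
    (h : HasGoodPairLabel P Q a) :
    pathHeight P.lower (a.1.val + 1) = pathHeight P.lower a.1 := by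
  rw [pathHeight_succ, if_neg h.1, add_zero]

theorem HasGoodPairLabel.pathHeight_upper_succ {n : ℕ} {P Q : LPM n} {a : Fin n × Fin n}
    (h : HasGoodPairLabel P Q a) :
    pathHeight P.upper (a.2.val + 1) = pathHeight P.upper a.2 := by
  rw [pathHeight_succ, if_neg h.2.2.1, add_zero]

theorem HasGoodPairLabel.isGoodPair_of_le {n : ℕ} {P Q : LPM n} {a : Fin n × Fin n}
    (h : HasGoodPairLabel P Q a) (hle : P ≤ Q) : P.IsGoodPair a := by
  have hl := h.pathHeight_lower
  have hu := h.pathHeight_upper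
  have hls := h.pathHeight_lower_succ
  have hus := h.pathHeight_upper_succ
  obtain ⟨l, u⟩ := a
  simp only at hl hu hls hus
  have hln := l.isLt
  have hun := u.isLt
  constructor
  · by_contra hc
    simp only [not_le] at hc
    have hul : u.val < l.val := by
      by_contra hc'
      have := pathHeight_mono P.lower (not_lt.1 hc')
      have := P.noncrossing u
      omega
    -- This base of `Q` touches the upper path of `Q` at `u + 1` and its lower path at `l`; in
    -- between it has one north step fewer than every base of `P` must have.
    obtain ⟨B, hB, hBh⟩ := Q.exists_path_clamp (fun _ => pathHeight P.upper u + 1)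
      (fun _ => by omega)
    obtain ⟨B', hsub, hB'⟩ := LPM.exists_path_subset_of_le hle hB
    have h1 := pathHeight_add_le_of_subset hsub (i := u.val + 1) (j := l.val) hul
    have h2 := hBh (u.val + 1) hun
    have h3 := hBh l.val hln.le
    have h4 := (hB'.2 l.val).1
    have h5 := (hB'.2 (u.val + 1)).2
    have h6 := Q.noncrossing (u.val + 1)
    have h7 := hl l.val
    have h8 := hu (u.val + 1)
    simp at h7 h8
    omega
  · by_contra hc
    simp only [not_le] at hc
    have hul : l.val < u.val := by
      by_contra hc'
      have := pathHeight_le_add_of_le P.upper (not_lt.1 hc')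
      have := P.noncrossing l
      omega
    -- Ensures that the truncated subtraction `l + 1 - pathHeight P.lower l` below is a true one.
    have hll := pathHeight_le_add_of_le P.lower (Nat.zero_le l.val)
    rw [pathHeight_zero] at hll
    -- The dual test: the diagonal profile gives a base of `P` on its lower path at `l + 1` and on
    -- its upper path at `u`, with one north step more in between than a base of `Q` can have.
    obtain ⟨B', hB', hBh⟩ := P.exists_path_clamp
      (fun i => i - (l.val + 1 - pathHeight P.lower l)) (fun _ => by omega)
    obtain ⟨B, hsub, hB⟩ := LPM.exists_path_superset_of_le hle hB'
    have h1 := pathHeight_add_le_of_subset hsub (i := l.val + 1) (j := u.val) hul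
    have h2 := hBh (l.val + 1) hln
    have h3 := hBh u.val hun.le
    have h4 := (hB.2 u.val).2
    have h5 := (hB.2 (l.val + 1)).1
    have h6 := P.noncrossing (l.val + 1)
    have h9 := P.noncrossing u
    have h7 := hu u.val
    have h8 := hl (l.val + 1)
    simp at h7 h8
    omega

/-! ### Exchange between the paths of two regions -/

theorem exists_mem_notMem_of_pathHeight_lt {n : ℕ} {A A' : Finset (Fin n)} {q p : ℕ}
    (hqp : q ≤ p)
    (h : pathHeight A' p + pathHeight A q < pathHeight A p + pathHeight A' q) :
    ∃ y : Fin n, q ≤ y.val ∧ y.val < p ∧ y ∈ A ∧ y ∉ A' := by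
  induction p, hqp using Nat.le_induction with
  | base => omega
  | succ p hp ih =>
    by_cases hc : pathHeight A' p + pathHeight A q < pathHeight A p + pathHeight A' q
    · obtain ⟨y, h1, h2, h3⟩ := ih hc
      exact ⟨y, h1, by omega, h3⟩
    · have hpn : p < n := by
        by_contra hn
        simp only [pathHeight_of_le _ (not_lt.1 hn),
          pathHeight_of_le _ ((not_lt.1 hn).trans (Nat.le_succ p))] at h hc
        exact hc h
      have h1 := pathHeight_succ A ⟨p, hpn⟩
      have h2 := pathHeight_succ A' ⟨p, hpn⟩
      refine ⟨⟨p, hpn⟩, hp, Nat.lt_succ_self p, ?_⟩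
      simp only at h1 h2
      split_ifs at h1 h2 <;> first | omega | tauto

/-- Since `x` itself favours `A'`, a weak inequality over the window forces a strict one in favour
of `A` before or after `x`. -/
theorem exists_mem_notMem_of_pathHeight_le {n : ℕ} {A A' : Finset (Fin n)} {q p : ℕ}
    {x : Fin n} (hqx : q ≤ x.val) (hxp : x.val < p) (hx' : x ∈ A') (hx : x ∉ A)
    (h : pathHeight A' p + pathHeight A q ≤ pathHeight A p + pathHeight A' q) :
    ∃ y : Fin n, q ≤ y.val ∧ y.val < p ∧ y ∈ A ∧ y ∉ A' := by
  have h1 := pathHeight_succ A x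
  have h2 := pathHeight_succ A' x
  rw [if_neg hx] at h1
  rw [if_pos hx'] at h2
  by_cases hc : pathHeight A' x + pathHeight A q < pathHeight A x + pathHeight A' q
  · obtain ⟨y, h3, h4, h5⟩ := exists_mem_notMem_of_pathHeight_lt hqx hc
    exact ⟨y, h3, h4.trans hxp, h5⟩
  · obtain ⟨y, h3, h4, h5⟩ :=
      exists_mem_notMem_of_pathHeight_lt (A := A) (A' := A') (q := x.val + 1) hxp (by omega)
    exact ⟨y, by omega, h4, h5⟩

theorem exists_first_le {f g : ℕ → ℕ} {m n : ℕ} (hm : m ≤ n) (hn : f n ≤ g n) :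
    ∃ p, m ≤ p ∧ p ≤ n ∧ f p ≤ g p ∧ ∀ i, m ≤ i → i < p → g i < f i := by
  induction n, hm using Nat.le_induction with
  | base => exact ⟨m, le_rfl, le_rfl, hn, fun i _ _ => by omega⟩
  | succ n hmn ih =>
    by_cases hc : ∃ i, m ≤ i ∧ i ≤ n ∧ f i ≤ g i
    · classical
      obtain ⟨h1, h2, h3⟩ := Nat.find_spec hc
      refine ⟨Nat.find hc, h1, by omega, h3, fun i hi hlt => ?_⟩
      by_contra h
      exact Nat.find_min hc hlt ⟨hi, by omega, by omega⟩
    · push Not at hc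
      exact ⟨n + 1, by omega, le_rfl, hn, fun i h1 h2 => hc i h1 (by omega)⟩

theorem exists_last_le {f g : ℕ → ℕ} (h0 : f 0 ≤ g 0) (m : ℕ) :
    ∃ q ≤ m, f q ≤ g q ∧ ∀ i, q < i → i ≤ m → g i < f i := by
  induction m with
  | zero => exact ⟨0, le_rfl, h0, fun i _ _ => by omega⟩
  | succ m ih =>
    by_cases hc : f (m + 1) ≤ g (m + 1)
    · exact ⟨m + 1, le_rfl, hc, fun i _ _ => by omega⟩
    · obtain ⟨q, h1, h2, h3⟩ := ih
      refine ⟨q, by omega, h2, fun i hi hi' => ?_⟩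
      rcases Nat.lt_or_ge m i with h | h
      · obtain rfl : i = m + 1 := by omega
        omega
      · exact h3 i hi h

section Exchange

variable {n : ℕ} {P Q : LPM n} {a : Fin n × Fin n} {A A' : Finset (Fin n)}

/-- A new step at `y` is admissible when `q ≤ y < p`, where `p` is the first contact of `A'` with
the lower path after `l` and `q` its last contact with the upper path up to `u`. The path `A` has
more north steps than `A'` in this window. -/
theorem HasGoodPairLabel.exists_insert (h : HasGoodPairLabel P Q a) (hg : P.IsGoodPair a)
    (hA' : IsPathBetween P.lower P.upper A') (hA : IsPathBetween Q.lower Q.upper A) :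
    ∃ y ∈ A, y ∉ A' ∧ IsPathBetween Q.lower Q.upper (insert y A') := by
  have hl := h.pathHeight_lower
  have hu := h.pathHeight_upper
  have hls := h.pathHeight_lower_succ
  have hus := h.pathHeight_upper_succ
  obtain ⟨-, hg⟩ := hg
  obtain ⟨l, u⟩ := a
  simp only at hl hu hls hus hg
  obtain ⟨p, hp1, hp2, hp3, hp4⟩ := exists_first_le (f := pathHeight A')
    (g := pathHeight P.lower) (m := l.val + 1) (n := n) l.isLt
    (by rw [pathHeight_last, pathHeight_last, hA'.1])
  obtain ⟨q, hq1, hq2, hq3⟩ := exists_last_le (f := pathHeight P.upper) (g := pathHeight A')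
    (by simp [pathHeight_zero]) u.val
  -- The east-step inequality of the good pair enters here: `p ≤ q` would give the upper path more
  -- east steps before `u` than the lower path has before `l`.
  have hqp : q < p := by
    by_contra hc
    have h1 := pathHeight_le_add_of_le A' (not_lt.1 hc)
    have h2 := pathHeight_le_add_of_le P.upper hq1
    have h3 := pathHeight_le_add_of_le P.lower hp1
    omega
  obtain ⟨y, hy1, hy2, hy3, hy4⟩ :=
    exists_mem_notMem_of_pathHeight_lt (A := A) (A' := A') hqp.le (by
      have h1 := (hA.2 p).1
      have h2 := (hA.2 q).2
      rw [hl p, if_pos (by omega)] at h1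
      rw [hu q, if_neg (by omega)] at h2
      omega)
  refine ⟨y, hy3, hy4, isPathBetween_of_forall_le Q.card_eq fun i hi => ?_⟩
  have h1 := hA'.2 i
  have h2 := hp4 i
  have h3 := hq3 i
  rw [hl, hu, pathHeight_insert hy4]
  split_ifs <;> omega

/-- Again `y` is sought between the contacts of `A'` with the bounding paths of `P` around `x`. Only
`u < q` together with `p ≤ l` could spoil the count, and the north-step inequality of the good pair
excludes it. -/
theorem HasGoodPairLabel.exists_insert_erase_lower (h : HasGoodPairLabel P Q a)
    (hg : P.IsGoodPair a) (hA' : IsPathBetween P.lower P.upper A')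
    (hA : IsPathBetween Q.lower Q.upper A) {x : Fin n} (hx' : x ∈ A') (hx : x ∉ A) :
    ∃ y ∈ A, y ∉ A' ∧ IsPathBetween P.lower P.upper (insert y (A'.erase x)) := by
  have hl := h.pathHeight_lower
  have hu := h.pathHeight_upper
  obtain ⟨hg, -⟩ := hg
  obtain ⟨l, u⟩ := a
  simp only at hl hu hg
  obtain ⟨p, hp1, hp2, hp3, hp4⟩ := exists_first_le (f := pathHeight A')
    (g := pathHeight P.lower) (m := x.val + 1) (n := n) x.isLt
    (by rw [pathHeight_last, pathHeight_last, hA'.1])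
  obtain ⟨q, hq1, hq2, hq3⟩ := exists_last_le (f := pathHeight P.upper) (g := pathHeight A')
    (by simp [pathHeight_zero]) x.val
  obtain ⟨y, hy1, hy2, hy3, hy4⟩ :=
    exists_mem_notMem_of_pathHeight_le hq1 hp1 hx' hx (by
      have h1 := (hA.2 p).1
      have h2 := (hA.2 q).2
      rw [hl p] at h1
      rw [hu q] at h2
      by_cases hc : u.val < q ∧ p ≤ l.val
      · have h3 := pathHeight_mono P.upper hc.1.le
        have h4 := pathHeight_mono P.lower hc.2
        have h5 := pathHeight_succ A' x
        have h6 := pathHeight_mono A' hq1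
        have h7 := pathHeight_mono A' hp1
        rw [if_pos hx'] at h5
        omega
      · split_ifs at h1 h2 <;> omega)
  refine ⟨y, hy3, hy4, isPathBetween_of_forall_le P.card_eq fun i hi => ?_⟩
  have h1 := hA'.2 i
  have h2 := hp4 i
  have h3 := hq3 i
  have h4 := pathHeight_insert_erase A' hx' hy4 i
  split_ifs at h4 <;> omega

/-- Here `q` and `p` are the contacts of `A` with the bounding paths of `Q` around `x`. If `q ≤ u`
and `l < p`, erasing `x` leaves a path of `P`; otherwise the window count yields an exchange.
Goodness of the pair plays no role. -/
theorem HasGoodPairLabel.erase_or_exists_insert_erase_upper (h : HasGoodPairLabel P Q a)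
    (hA' : IsPathBetween P.lower P.upper A') (hA : IsPathBetween Q.lower Q.upper A) {x : Fin n}
    (hx : x ∈ A) (hx' : x ∉ A') :
    IsPathBetween P.lower P.upper (A.erase x) ∨
      ∃ y ∈ A', y ∉ A ∧ IsPathBetween Q.lower Q.upper (insert y (A.erase x)) := by
  have hl := h.pathHeight_lower
  have hu := h.pathHeight_upper
  obtain ⟨l, u⟩ := a
  simp only at hl hu
  obtain ⟨p, hp1, hp2, hp3, hp4⟩ := exists_first_le (f := pathHeight A)
    (g := pathHeight Q.lower) (m := x.val + 1) (n := n) x.isLt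
    (by rw [pathHeight_last, pathHeight_last, hA.1])
  obtain ⟨q, hq1, hq2, hq3⟩ := exists_last_le (f := pathHeight Q.upper) (g := pathHeight A)
    (by simp [pathHeight_zero]) x.val
  by_cases hc : q ≤ u.val ∧ l.val < p
  · refine Or.inl (isPathBetween_of_forall_le P.card_eq fun i hi => ?_)
    have h1 := hA.2 i
    have h2 := hp4 i
    have h3 := hq3 i
    have h4 := pathHeight_erase hx i
    rw [hl, hu] at *
    split_ifs at * <;> omega
  · obtain ⟨y, hy1, hy2, hy3, hy4⟩ :=
      exists_mem_notMem_of_pathHeight_le (A := A') (A' := A) hq1 hp1 hx hx' (by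
        have h1 := (hA'.2 p).1
        have h2 := (hA'.2 q).2
        rw [hl p] at hp3
        rw [hu q] at hq2
        split_ifs at hp3 hq2 <;> omega)
    refine Or.inr ⟨y, hy3, hy4, isPathBetween_of_forall_le Q.card_eq fun i hi => ?_⟩
    have h1 := hA.2 i
    have h2 := hp4 i
    have h3 := hq3 i
    have h4 := pathHeight_insert_erase A hx hy4 i
    split_ifs at h4 <;> omega

end Exchange

/-! ### Elementary quotients -/

/-- Two matroids whose bases satisfy the mixed exchange properties are the deletion and the
contraction of a one-element extension. -/
theorem Matroid.isQuotientOf_of_exchange {α : Type*} [Finite α] {M' M : Matroid α}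
    (hE' : M'.E = Set.univ) (hE : M.E = Set.univ)
    (h1 : ∀ A A', M.IsBase A → M'.IsBase A' → ∀ x ∈ A, x ∉ A' →
      M'.IsBase (A \ {x}) ∨ ∃ y ∈ A', y ∉ A ∧ M.IsBase (insert y (A \ {x})))
    (h2 : ∀ A A', M.IsBase A → M'.IsBase A' → ∃ y ∈ A, y ∉ A' ∧ M.IsBase (insert y A'))
    (h3 : ∀ A A', M.IsBase A → M'.IsBase A' → ∀ x ∈ A', x ∉ A →
      ∃ y ∈ A, y ∉ A' ∧ M'.IsBase (insert y (A' \ {x}))) :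
    M'.IsQuotientOf M := by
  -- With `e = Sum.inr 0` the new element, the bases avoiding `e` are those of `M`, and the bases
  -- containing `e` are those of `M'` with `e` added.
  let IsB : Set (α ⊕ Fin 1) → Prop := fun B =>
    (Sum.inr 0 ∉ B ∧ M.IsBase (Sum.inl ⁻¹' B)) ∨ (Sum.inr 0 ∈ B ∧ M'.IsBase (Sum.inl ⁻¹' B))
  have hpre : ∀ (x y : α) (A : Set (α ⊕ Fin 1)),
      Sum.inl ⁻¹' (insert (Sum.inl y) (A \ {Sum.inl x}))
        = insert y ((Sum.inl ⁻¹' A : Set α) \ {x}) := by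
    intro x y A
    ext z
    simp
  have hpre2 : ∀ (y : α) (A : Set (α ⊕ Fin 1)),
      Sum.inl ⁻¹' (insert (Sum.inl y) (A \ {Sum.inr 0}))
        = insert y (Sum.inl ⁻¹' A : Set α) := by
    intro y A
    ext z
    simp
  have hpre3 : ∀ (x : α) (A : Set (α ⊕ Fin 1)),
      Sum.inl ⁻¹' (insert (Sum.inr 0) (A \ {Sum.inl x}))
        = (Sum.inl ⁻¹' A : Set α) \ {x} := by
    intro y A
    ext z
    simp
  -- Bases of the same kind exchange inside `M` or `M'`, unless `e` itself is removed. The mixed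
  -- cases are `h1` and `h3` for an old element and `h2` for the removal of `e`.
  have hex : Matroid.ExchangeProperty IsB := by
    rintro A B hA hB (x | x) ⟨hxA, hxB⟩
    · rcases hA with ⟨hA0, hA⟩ | ⟨hA0, hA⟩ <;> rcases hB with ⟨hB0, hB⟩ | ⟨hB0, hB⟩
      · obtain ⟨y, ⟨hy1, hy2⟩, hy⟩ := hA.exchange hB (e := x) ⟨hxA, hxB⟩
        exact ⟨Sum.inl y, ⟨hy1, hy2⟩, Or.inl ⟨by simpa using hA0, by rwa [hpre]⟩⟩
      · rcases h1 _ _ hA hB x hxA hxB with hy | ⟨y, hy1, hy2, hy⟩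
        · exact ⟨Sum.inr 0, ⟨hB0, hA0⟩, Or.inr ⟨by simp, by rwa [hpre3]⟩⟩
        · exact ⟨Sum.inl y, ⟨hy1, hy2⟩, Or.inl ⟨by simpa using hA0, by rwa [hpre]⟩⟩
      · obtain ⟨y, hy1, hy2, hy⟩ := h3 _ _ hB hA x hxA hxB
        exact ⟨Sum.inl y, ⟨hy1, hy2⟩, Or.inr ⟨by simpa using hA0, by rwa [hpre]⟩⟩
      · obtain ⟨y, ⟨hy1, hy2⟩, hy⟩ := hA.exchange hB (e := x) ⟨hxA, hxB⟩
        exact ⟨Sum.inl y, ⟨hy1, hy2⟩, Or.inr ⟨by simpa using hA0, by rwa [hpre]⟩⟩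
    · obtain rfl : x = 0 := Subsingleton.elim _ _
      rcases hA with ⟨hA0, hA⟩ | ⟨hA0, hA⟩
      · exact absurd hxA hA0
      rcases hB with ⟨hB0, hB⟩ | ⟨hB0, hB⟩
      · obtain ⟨y, hy1, hy2, hy⟩ := h2 _ _ hB hA
        exact ⟨Sum.inl y, ⟨hy1, hy2⟩, Or.inl ⟨by simp, by rwa [hpre2]⟩⟩
      · exact absurd hB0 hxB
  obtain ⟨B, hB⟩ := M.exists_isBase
  obtain ⟨B', hB'⟩ := M'.exists_isBase
  have hBB : IsB (Sum.inl '' B) :=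
    Or.inl ⟨by simp, by rwa [Set.preimage_image_eq _ Sum.inl_injective]⟩
  have hBB' : IsB (insert (Sum.inr 0) (Sum.inl '' B')) := by
    refine Or.inr ⟨by simp, ?_⟩
    have : Sum.inl ⁻¹' (insert (Sum.inr 0 : α ⊕ Fin 1) (Sum.inl '' B')) = B' := by
      ext z
      simp
    rwa [this]
  let N : Matroid (α ⊕ Fin 1) := Matroid.ofExistsFiniteIsBase Set.univ IsB
    ⟨_, hBB, Set.toFinite _⟩ hex (fun _ _ => Set.subset_univ _)
  have hN : ∀ X, N.IsBase X ↔ IsB X := fun X => by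
    simp only [N, Matroid.ofExistsFiniteIsBase_isBase]
  have hNE : N.E = Set.univ := rfl
  have hT : (Set.range Sum.inr : Set (α ⊕ Fin 1)) = {Sum.inr 0} := by
    rw [Set.range_unique]
    rfl
  have hdis : ∀ X : Set (α ⊕ Fin 1), X ⊆ Set.range Sum.inl ↔ Sum.inr 0 ∉ X := by
    intro X
    constructor
    · intro hX h0
      obtain ⟨y, hy⟩ := hX h0
      simp at hy
    · rintro h0 (x | x) hx
      · exact ⟨x, rfl⟩
      · obtain rfl : x = 0 := Subsingleton.elim _ _
        exact absurd hx h0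
  have hgr : (Set.univ : Set (α ⊕ Fin 1)) \ {Sum.inr 0} = Sum.inl '' Set.univ := by
    ext (x | x)
    · simp
    · obtain rfl : x = 0 := Subsingleton.elim _ _
      simp
  refine ⟨1, N, ?_, ?_⟩
  -- As some base avoids `e`, the bases of the deletion are the bases of `N` avoiding `e`; the
  -- contraction is dual.
  · have hco : N.Coindep (Set.range Sum.inr) := by
      rw [Matroid.coindep_iff_exists]
      refine ⟨_, (hN _).2 hBB, ?_⟩
      rw [hNE, hT, hgr]
      exact Set.image_mono (Set.subset_univ _)
    refine Matroid.ext_isBase ?_ fun X _ => ?_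
    · rw [Matroid.delete_ground, hNE, hT, hgr, Matroid.mapEmbedding_ground_eq, hE]
      rfl
    · rw [hco.delete_isBase_iff, Matroid.mapEmbedding_isBase_iff, hN, hT,
        Set.disjoint_singleton_right]
      rw [show Set.range (Function.Embedding.inl : α ↪ α ⊕ Fin 1) = Set.range Sum.inl from rfl,
        hdis]
      simp only [IsB]
      exact ⟨fun hX => hX.1.elim (fun hX' => ⟨hX'.2, hX'.1⟩) (fun hX' => absurd hX'.1 hX.2),
        fun hX => ⟨Or.inl ⟨hX.2, hX.1⟩, hX.2⟩⟩
  · have hind : N.Indep (Set.range Sum.inr) := by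
      rw [hT]
      exact ((hN _).2 hBB').indep.subset (by simp)
    refine Matroid.ext_isBase ?_ fun X hX => ?_
    · rw [Matroid.contract_ground, hNE, hT, hgr, Matroid.mapEmbedding_ground_eq, hE']
      rfl
    · rw [hind.contract_isBase_iff, Matroid.mapEmbedding_isBase_iff, hN, hT,
        Set.disjoint_singleton_right]
      have hpre4 : Sum.inl ⁻¹' (X ∪ {Sum.inr 0}) = (Sum.inl ⁻¹' X : Set α) := by
        ext z
        simp
      rw [show Set.range (Function.Embedding.inl : α ↪ α ⊕ Fin 1) = Set.range Sum.inl from rfl,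
        hdis]
      have h0 : (Sum.inr 0 : α ⊕ Fin 1) ∈ X ∪ {Sum.inr 0} := Or.inr rfl
      simp only [IsB, hpre4, h0, not_true, false_and, true_and, false_or]
      exact Iff.rfl

theorem HasGoodPairLabel.le_of_isGoodPair {n : ℕ} {P Q : LPM n} {a : Fin n × Fin n}
    (h : HasGoodPairLabel P Q a) (hg : P.IsGoodPair a) : P ≤ Q := by
  have hb : ∀ (R : LPM n) (B : Set (Fin n)), R.toMatroid.IsBase B →
      ∃ F : Finset (Fin n), (F : Set (Fin n)) = B ∧ IsPathBetween R.lower R.upper F :=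
    fun _ _ h => h
  refine Matroid.isQuotientOf_of_exchange rfl rfl ?_ ?_ ?_
  · intro A A' hA hA' x hx hx'
    obtain ⟨A, rfl, hF⟩ := hb _ _ hA
    obtain ⟨A', rfl, hF'⟩ := hb _ _ hA'
    rcases h.erase_or_exists_insert_erase_upper hF' hF (Finset.mem_coe.1 hx)
      (fun hh => hx' (Finset.mem_coe.2 hh)) with he | ⟨y, hy1, hy2, hy⟩
    · exact Or.inl ⟨_, by simp, he⟩
    · exact Or.inr ⟨y, hy1, hy2, _, by simp, hy⟩
  · intro A A' hA hA'
    obtain ⟨A, rfl, hF⟩ := hb _ _ hA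
    obtain ⟨A', rfl, hF'⟩ := hb _ _ hA'
    obtain ⟨y, hy1, hy2, hy⟩ := h.exists_insert hg hF' hF
    exact ⟨y, hy1, hy2, _, by simp, hy⟩
  · intro A A' hA hA' x hx' hx
    obtain ⟨A, rfl, hF⟩ := hb _ _ hA
    obtain ⟨A', rfl, hF'⟩ := hb _ _ hA'
    obtain ⟨y, hy1, hy2, hy⟩ := h.exists_insert_erase_lower hg hF' hF (Finset.mem_coe.1 hx')
      (fun hh => hx (Finset.mem_coe.2 hh))
    exact ⟨y, hy1, hy2, _, by simp, hy⟩

/-- A label occurs on a cover exactly when it is a good pair. -/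
theorem HasGoodPairLabel.covBy_iff {n : ℕ} {P Q : LPM n} {a : Fin n × Fin n}
    (h : HasGoodPairLabel P Q a) : P ⋖ Q ↔ P.IsGoodPair a := by
  refine ⟨fun hc => h.isGoodPair_of_le hc.lt.1, fun hg => ?_⟩
  refine LPM.covBy_of_le_of_card_eq (h.le_of_isGoodPair hg) ?_
  rw [h.2.1, Finset.card_insert_of_notMem h.1]

/-! ### Maximal chains from pairs of permutations -/

/-- The set of the first `i` values of `σ`. -/
def firstValues {n : ℕ} (σ : Equiv.Perm (Fin n)) (i : ℕ) : Finset (Fin n) :=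
  (Finset.univ.filter fun s : Fin n => s.val < i).image σ

section FirstValues

variable {n : ℕ} (σ τ : Equiv.Perm (Fin n))

theorem mem_firstValues {i : ℕ} {s : Fin n} : σ s ∈ firstValues σ i ↔ s.val < i := by
  simp [firstValues]

theorem firstValues_zero : firstValues σ 0 = ∅ := by
  simp [firstValues]

theorem firstValues_self : firstValues σ n = Finset.univ := by
  simp [firstValues]

theorem firstValues_succ (t : Fin n) :
    firstValues σ (t.val + 1) = insert (σ t) (firstValues σ t) := by
  rw [firstValues, firstValues, ← Finset.image_insert]
  congr 1
  ext s
  simp only [Finset.mem_filter, Finset.mem_univ, true_and, Finset.mem_insert, Fin.ext_iff]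
  omega

theorem card_firstValues (i : ℕ) : (firstValues σ i).card = (firstValues τ i).card := by
  rw [firstValues, firstValues, Finset.card_image_of_injective _ σ.injective,
    Finset.card_image_of_injective _ τ.injective]

theorem pathHeight_firstValues (t : Fin n) :
    pathHeight (firstValues σ t) (σ t)
      = (Finset.univ.filter fun s : Fin n => s < t ∧ σ s < σ t).card := by
  rw [pathHeight, firstValues, Finset.filter_image, Finset.filter_filter,
    Finset.card_image_of_injective _ σ.injective]
  rfl

/-- The `σ t` smaller values are split by whether they occur before or after `t`. The second
good-pair inequality thus compares the numbers of smaller values still to come. -/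
theorem val_eq_pathHeight_firstValues_add (t : Fin n) :
    (σ t).val = pathHeight (firstValues σ t) (σ t)
      + (Finset.univ.filter fun s : Fin n => t < s ∧ σ s < σ t).card := by
  rw [pathHeight_firstValues, ← Finset.card_union_of_disjoint]
  · rw [← Fin.card_Iio (σ t), ← Finset.card_map σ.symm.toEmbedding]
    congr 1
    ext s
    simp only [Finset.mem_map_equiv, Equiv.symm_symm, Finset.mem_Iio, Finset.mem_union,
      Finset.mem_filter, Finset.mem_univ, true_and]
    constructor
    · intro h
      rcases lt_trichotomy s t with h' | rfl | h'
      · exact Or.inl ⟨h', h⟩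
      · exact absurd h (lt_irrefl _)
      · exact Or.inr ⟨h', h⟩
    · rintro (h | h) <;> exact h.2
  · rw [Finset.disjoint_filter]
    rintro s - ⟨h1, -⟩ ⟨h2, -⟩
    exact lt_asymm h1 h2

/-- Every step of the pair of permutations satisfies the condition of `LPM.IsGoodPair`. -/
def IsGoodPermPair {n : ℕ} (σ τ : Equiv.Perm (Fin n)) : Prop :=
  ∀ t : Fin n, pathHeight (firstValues σ t) (σ t) ≤ pathHeight (firstValues τ t) (τ t) ∧
    (τ t).val + pathHeight (firstValues σ t) (σ t)
      ≤ (σ t).val + pathHeight (firstValues τ t) (τ t)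

variable {σ τ}

theorem lt_of_lt_of_inversions_subset {σ' : Equiv.Perm (Fin n)}
    (h : inversions σ ⊆ inversions σ') {s t : Fin n} (hst : s < t) (hlt : σ' s < σ' t) :
    σ s < σ t := by
  by_contra hc
  have hne : σ t ≠ σ s := fun e => hst.ne (σ.injective e).symm
  have : (s, t) ∈ inversions σ := mem_inversions.2 ⟨hst, lt_of_le_of_ne (not_lt.1 hc) hne⟩
  exact lt_asymm hlt (mem_inversions.1 (h this)).2

/-- More inversions mean fewer smaller values before `t` and more after it, and both changes relax
the conditions on `σ`. -/
theorem IsGoodPermPair.of_inversions_subset {σ' : Equiv.Perm (Fin n)} (hg : IsGoodPermPair σ τ)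
    (h : inversions σ ⊆ inversions σ') : IsGoodPermPair σ' τ := by
  intro t
  have h1 : (Finset.univ.filter fun s : Fin n => s < t ∧ σ' s < σ' t).card
      ≤ (Finset.univ.filter fun s : Fin n => s < t ∧ σ s < σ t).card :=
    Finset.card_le_card (Finset.monotone_filter_right _ fun s _ hs =>
      ⟨hs.1, lt_of_lt_of_inversions_subset h hs.1 hs.2⟩)
  have h2 : (Finset.univ.filter fun s : Fin n => t < s ∧ σ s < σ t).card
      ≤ (Finset.univ.filter fun s : Fin n => t < s ∧ σ' s < σ' t).card :=
    Finset.card_le_card (Finset.monotone_filter_right _ fun s _ hs =>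
      mem_inversions.1 (h ((mem_inversions (p := (t, s))).2 hs)))
  have h3 := val_eq_pathHeight_firstValues_add σ t
  have h4 := val_eq_pathHeight_firstValues_add σ' t
  rw [← pathHeight_firstValues, ← pathHeight_firstValues] at h1
  obtain ⟨h5, h6⟩ := hg t
  constructor <;> omega

/-- Only `a.1 < k ≤ a.2` is critical; there monotonicity of east steps along both paths reduces the
claim to the second inequality of the good pair. -/
theorem LPM.IsGoodPair.noncrossing_insert {P : LPM n} {a : Fin n × Fin n} (hg : P.IsGoodPair a)
    (hl : a.1 ∉ P.lower) (hu : a.2 ∉ P.upper) (k : ℕ) :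
    pathHeight (insert a.1 P.lower) k ≤ pathHeight (insert a.2 P.upper) k := by
  rw [pathHeight_insert hl, pathHeight_insert hu]
  have h1 := P.noncrossing k
  have h2 := hg.2
  have h3 := pathHeight_succ P.lower a.1
  rw [if_neg hl] at h3
  by_cases hk : a.1.val < k ∧ k ≤ a.2.val
  · have h4 := pathHeight_le_add_of_le P.lower (i := a.1.val + 1) hk.1
    have h5 := pathHeight_le_add_of_le P.upper hk.2
    split_ifs <;> omega
  · split_ifs <;> omega

theorem IsGoodPermPair.noncrossing (h : IsGoodPermPair σ τ) {i : ℕ} (hi : i ≤ n) (k : ℕ) :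
    pathHeight (firstValues σ i) k ≤ pathHeight (firstValues τ i) k := by
  induction i generalizing k with
  | zero => rw [firstValues_zero, firstValues_zero]
  | succ i ih =>
    let P : LPM n := ⟨firstValues τ i, firstValues σ i, card_firstValues τ σ i, ih (by omega)⟩
    have hP : P.IsGoodPair (σ ⟨i, hi⟩, τ ⟨i, hi⟩) := h ⟨i, hi⟩
    have := hP.noncrossing_insert (fun hh => lt_irrefl _ ((mem_firstValues σ).1 hh))
      (fun hh => lt_irrefl _ ((mem_firstValues τ).1 hh)) k
    rwa [← firstValues_succ, ← firstValues_succ] at this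

/-- A good pair of permutations labels a maximal chain. -/
theorem IsGoodPermPair.exists_isChainOfPair (h : IsGoodPermPair σ τ) :
    ∃ x : Fin (n + 1) → LPM n, IsChainOfPair x σ τ := by
  let x : Fin (n + 1) → LPM n := fun i => ⟨firstValues τ i, firstValues σ i,
    card_firstValues τ σ i, h.noncrossing (Nat.lt_succ_iff.1 i.isLt)⟩
  have hlab : ∀ i : Fin n, HasGoodPairLabel (x i.castSucc) (x i.succ) (σ i, τ i) := fun i =>
    ⟨fun hh => lt_irrefl _ ((mem_firstValues σ).1 hh), firstValues_succ σ i,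
      fun hh => lt_irrefl _ ((mem_firstValues τ).1 hh), firstValues_succ τ i⟩
  refine ⟨x, ⟨?_, ?_, fun i => (hlab i).covBy_iff.2 (h i)⟩, hlab⟩
  · exact LPM.ext (firstValues_zero τ) (firstValues_zero σ)
  · exact LPM.ext (firstValues_self τ) (firstValues_self σ)

theorem IsChainOfPair.eq_firstValues {x : Fin (n + 1) → LPM n} (h : IsChainOfPair x σ τ)
    (i : Fin (n + 1)) :
    (x i).lower = firstValues σ i ∧ (x i).upper = firstValues τ i := by
  induction i using Fin.induction with
  | zero =>
    rw [h.1.1]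
    exact ⟨(firstValues_zero σ).symm, (firstValues_zero τ).symm⟩
  | succ i ih =>
    rw [(h.2 i).2.1, (h.2 i).2.2.2, ih.1, ih.2]
    exact ⟨(firstValues_succ σ i).symm, (firstValues_succ τ i).symm⟩

theorem IsChainOfPair.isGoodPermPair {x : Fin (n + 1) → LPM n} (h : IsChainOfPair x σ τ) :
    IsGoodPermPair σ τ := by
  intro t
  have hg := (h.2 t).covBy_iff.1 (h.1.2.2 t)
  have he := h.eq_firstValues t.castSucc
  rw [LPM.IsGoodPair, he.1, he.2] at hg
  exact hg

end FirstValues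

/-! ### Falling chains and the injection -/

theorem HasGoodPairLabel.unique {n : ℕ} {P Q : LPM n} {a b : Fin n × Fin n}
    (ha : HasGoodPairLabel P Q a) (hb : HasGoodPairLabel P Q b) : a = b := by
  refine Prod.ext ?_ ?_
  · have h : a.1 ∈ insert b.1 P.lower := hb.2.1 ▸ ha.2.1 ▸ Finset.mem_insert_self _ _
    exact (Finset.mem_insert.1 h).resolve_right ha.1
  · have h : a.2 ∈ insert b.2 P.upper := hb.2.2.2 ▸ ha.2.2.2 ▸ Finset.mem_insert_self _ _
    exact (Finset.mem_insert.1 h).resolve_right ha.2.2.1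

theorem IsChainOfPair.isFallingChain_iff {n : ℕ} {σ τ : Equiv.Perm (Fin n)}
    {x : Fin (n + 1) → LPM n} (h : IsChainOfPair x σ τ) :
    IsFallingChain x ↔
      ∀ i j : Fin n, i.val + 1 = j.val → σ i < σ j → ¬ τ i < τ j := by
  -- Distinct positions give labels differing in both coordinates, so the strict product order is
  -- strict in each.
  have hiff : ∀ i j : Fin n, i.val + 1 = j.val →
      ((σ i, τ i) < (σ j, τ j) ↔ σ i < σ j ∧ τ i < τ j) := by
    intro i j hij
    have hne : i ≠ j := fun e => by rw [e] at hij; omega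
    have h1 : σ i ≠ σ j := fun e => hne (σ.injective e)
    have h2 : τ i ≠ τ j := fun e => hne (τ.injective e)
    rw [Prod.mk_lt_mk, h1.le_iff_lt, h2.le_iff_lt]
    tauto
  constructor
  · rintro ⟨-, m, hm, hf⟩ i j hij h1 h2
    refine hf i j hij ?_
    rw [(hm i).unique (h.2 i), (hm j).unique (h.2 j)]
    exact (hiff i j hij).2 ⟨h1, h2⟩
  · intro hf
    refine ⟨h.1, fun i => (σ i, τ i), h.2, fun i j hij hlt => ?_⟩
    obtain ⟨h1, h2⟩ := (hiff i j hij).1 hlt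
    exact hf i j hij h1 h2

theorem theorem3p14 {n : ℕ} (σ σ' : Equiv.Perm (Fin n)) (h : LeftBruhatLE σ σ') :
    (fallingChains σ).ncard ≤ (fallingChains σ').ncard := by
  have hinv := h.inversions_subset
  -- The upper paths depend on `τ` alone, so keeping `τ` keeps them.
  have key : ∀ x ∈ fallingChains σ, ∃ y ∈ fallingChains σ',
      ∀ i, (y i).upper = (x i).upper := by
    rintro x ⟨hf, τ, hx⟩
    obtain ⟨y, hy⟩ := (hx.isGoodPermPair.of_inversions_subset hinv).exists_isChainOfPair
    refine ⟨y, ⟨hy.isFallingChain_iff.2 fun i j hij hlt => ?_, τ, hy⟩, fun i => ?_⟩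
    · refine hx.isFallingChain_iff.1 hf i j hij (lt_of_lt_of_inversions_subset hinv ?_ hlt)
      exact Fin.lt_def.2 (by omega)
    · rw [(hy.eq_firstValues i).2, (hx.eq_firstValues i).2]
  choose! f hf hup using key
  refine Set.ncard_le_ncard_of_injOn f hf ?_ (Set.toFinite _)
  intro x hx z hz e
  obtain ⟨τ, hx'⟩ := hx.2
  obtain ⟨ρ, hz'⟩ := hz.2
  funext i
  -- Injectivity: the upper paths are recovered from the image, and the lower paths are fixed by
  -- `σ`.
  refine LPM.ext ?_ ?_
  · rw [← hup x hx i, ← hup z hz i, e]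
  · rw [(hx'.eq_firstValues i).1, (hz'.eq_firstValues i).1]
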